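/- Let $A,B,C\in\mathrm{SL}(3,\mathbb{C})$ satisfy $CBA=I$ and $$\mathrm{tr}(A^{-1})=\mathrm{tr}(A),\quad \mathrm{tr}(B^{-1})=\mathrm{tr}(B),\quad \mathrm{tr}(C^{-1})=\mathrm{tr}(C),\quad \mathrm{tr}([A,B]^{-1})=\mathrm{tr}([A,B]),$$ where $[A,B]=ABA^{-1}B^{-1}$. Define the shape invariants $$\sigma_+=\mathrm{tr}(A^{-1}B)-\mathrm{tr}(A^{-1})\,\mathrm{tr}(B),\qquad \sigma_-=\mathrm{tr}(B^{-1}A)-\mathrm{tr}(B^{-1})\,\mathrm{tr}(A),$$ and suppose that $\sigma_+=\sigma_-$. If $\sigma_+=3-\mathrm{tr}(A)-\mathrm{tr}(B)-\mathrm{tr}(C)$, then the subgroup $\langle A,B,C\rangle$ of $\mathrm{SL}(3,\mathbb{C})$ generated by $A,B,C$ is reducible, that is, there is a linear subspace $W$ of $\mathbb{C}^3$ with $W\neq\{0\}$ and $W\neq\mathbb{C}^3$ which is mapped into itself by every element of $\langle A,B,C\rangle$. -/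

import Mathlib

open scoped MatrixGroups commutatorElement

noncomputable section

/-- The trace of an element of `SL(3,ℂ)`. -/
def slTrace (A : SL(3, ℂ)) : ℂ := Matrix.trace (A : Matrix (Fin 3) (Fin 3) ℂ)

/-- The shape invariant `σ₊ = tr(A⁻¹B) - tr(A⁻¹) tr(B)` of a triple `(A, B, C)` with `CBA = I`
(its formula involves only `A` and `B`). -/
def shapePlus (A B : SL(3, ℂ)) : ℂ := slTrace (A⁻¹ * B) - slTrace A⁻¹ * slTrace B

/-- The shape invariant `σ₋ = tr(B⁻¹A) - tr(B⁻¹) tr(A)` of a triple `(A, B, C)` with `CBA = I`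
(its formula involves only `A` and `B`). -/
def shapeMinus (A B : SL(3, ℂ)) : ℂ := slTrace (B⁻¹ * A) - slTrace B⁻¹ * slTrace A

/-- The action of a subgroup `G` of `SL(3,ℂ)` on the column vectors `ℂ³`, as a representation. -/
def standardRep (G : Subgroup SL(3, ℂ)) : Representation ℂ G (Fin 3 → ℂ) where
  toFun g := Matrix.toLin' ((g : SL(3, ℂ)) : Matrix (Fin 3) (Fin 3) ℂ)
  map_one' := by simp; rfl
  map_mul' g h := by simp [Matrix.toLin'_mul]; rfl

/-- A subgroup of `SL(3,ℂ)` is reducible if its action on `ℂ³` is not irreducible, that is, if some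
subspace other than `0` and `ℂ³` is invariant under it. -/
def IsReducibleSubgroup (G : Subgroup SL(3, ℂ)) : Prop := ¬ (standardRep G).IsIrreducible

end

/-!
For `A ∈ SL(3)` the adjugate of `A - 1` is `A + A⁻¹ + (1 - tr A) • 1`. If `tr A⁻¹ = tr A`, then
`A - 1` is singular and its adjugate is either zero or `v ⊗ φ` with `v` a vector and `φ` a covector
fixed by `A`. The shape condition says that `tr (adj (A - 1) (B - 1))`, that is `φ ((B - 1) v)`,
vanishes, also with `B⁻¹` in place of `B` and with the roles of `A` and `B` exchanged. In the
generic case let `ψ` be the covector fixed by `B`: then `u = (B⁻¹ - 1) v` and `B u = -(B - 1) v`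
both lie on the line `ker φ ∩ ker ψ`, which is therefore an eigenline of `B`, and by symmetry of
`A`. In the degenerate cases `A` and `B` fix a common vector or covector.
-/

open Matrix

section Eigenvectors

variable {n R : Type*} [Fintype n] [CommRing R] {A : Matrix n n R} {v φ : n → R}

lemma mulVec_mem_span_singleton {a : R} (h : A *ᵥ v = a • v) :
    ∀ w ∈ Submodule.span R {v}, A *ᵥ w ∈ Submodule.span R {v} := by
  intro w hw
  obtain ⟨c, rfl⟩ := Submodule.mem_span_singleton.mp hw
  rw [mulVec_smul, h]
  exact Submodule.smul_mem _ _ (Submodule.smul_mem _ _ (Submodule.mem_span_singleton_self v))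

lemma mulVec_mem_ker_dotProduct {a : R} (h : φ ᵥ* A = a • φ) :
    ∀ w ∈ LinearMap.ker (dotProductBilin R R φ),
      A *ᵥ w ∈ LinearMap.ker (dotProductBilin R R φ) := by
  intro w hw
  replace hw : φ ⬝ᵥ w = 0 := hw
  change φ ⬝ᵥ A *ᵥ w = 0
  rw [dotProduct_mulVec, h, smul_dotProduct, hw, smul_zero]

end Eigenvectors

section InvariantSubspaces

variable {n K : Type*} [Fintype n] [Field K]

/-- `A` and `B` have a common invariant subspace other than `0` and the whole space. -/
def ShareInvariantSubspace (A B : Matrix n n K) : Prop :=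
  ∃ W : Submodule K (n → K), W ≠ ⊥ ∧ W ≠ ⊤ ∧ (∀ w ∈ W, A *ᵥ w ∈ W) ∧ ∀ w ∈ W, B *ᵥ w ∈ W

variable {A B : Matrix n n K} {v φ : n → K}

lemma ShareInvariantSubspace.symm (h : ShareInvariantSubspace A B) :
    ShareInvariantSubspace B A :=
  let ⟨W, hbot, htop, hA, hB⟩ := h
  ⟨W, hbot, htop, hB, hA⟩

variable [Nontrivial n]

lemma shareInvariantSubspace_of_eigenvector (hv : v ≠ 0) {a b : K}
    (hA : A *ᵥ v = a • v) (hB : B *ᵥ v = b • v) : ShareInvariantSubspace A B := by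
  refine ⟨Submodule.span K {v}, mt Submodule.span_singleton_eq_bot.mp hv, fun htop => ?_,
    mulVec_mem_span_singleton hA, mulVec_mem_span_singleton hB⟩
  have hcard : 1 = Fintype.card n := by
    rw [← finrank_span_singleton (K := K) hv, htop, finrank_top, Module.finrank_fintype_fun_eq_card]
  exact Fintype.one_lt_card.ne hcard

lemma shareInvariantSubspace_of_eigencovector (hφ : φ ≠ 0) {a b : K}
    (hA : φ ᵥ* A = a • φ) (hB : φ ᵥ* B = b • φ) : ShareInvariantSubspace A B := by
  refine ⟨LinearMap.ker (dotProductBilin K K φ), fun hbot => ?_, fun htop => hφ ?_,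
    mulVec_mem_ker_dotProduct hA, mulVec_mem_ker_dotProduct hB⟩
  · obtain ⟨w, hw, hwφ⟩ := exists_ne_zero_dotProduct_eq_zero φ
    have hmem : w ∈ LinearMap.ker (dotProductBilin K K φ) := (dotProduct_comm φ w).trans hwφ
    exact hw ((Submodule.mem_bot K).mp (hbot ▸ hmem))
  · refine dotProduct_eq_zero φ fun w => ?_
    exact (htop ▸ Submodule.mem_top : w ∈ LinearMap.ker (dotProductBilin K K φ))

lemma shareInvariantSubspace_of_fixed_vector (hv : v ≠ 0) (hA : A *ᵥ v = v) (hB : B *ᵥ v = v) :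
    ShareInvariantSubspace A B :=
  shareInvariantSubspace_of_eigenvector hv (a := 1) (b := 1) (by rw [hA, one_smul])
    (by rw [hB, one_smul])

lemma shareInvariantSubspace_of_fixed_covector (hφ : φ ≠ 0) (hA : φ ᵥ* A = φ) (hB : φ ᵥ* B = φ) :
    ShareInvariantSubspace A B :=
  shareInvariantSubspace_of_eigencovector hφ (a := 1) (b := 1) (by rw [hA, one_smul])
    (by rw [hB, one_smul])

end InvariantSubspaces

section Stabilizers

variable {n K : Type*} [Fintype n] [DecidableEq n] [Field K]

open scoped Pointwise in
lemma mem_stabilizer_submodule_iff_forall_mulVec_mem {W : Submodule K (n → K)}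
    {g : SpecialLinearGroup n K} :
    g ∈ MulAction.stabilizer (SpecialLinearGroup n K) W ↔ ∀ w ∈ W, g.1 *ᵥ w ∈ W := by
  refine ⟨fun hg w hw => ?_, fun hg => ?_⟩
  · have hgw : g • w ∈ g • W := Submodule.smul_mem_pointwise_smul w g W hw
    rwa [MulAction.mem_stabilizer_iff.mp hg] at hgw
  · exact Submodule.eq_of_le_of_finrank_eq (Submodule.map_le_iff_le_comap.mpr hg)
      (LinearEquiv.finrank_map_eq (SpecialLinearGroup.toLin' g) W)

lemma ShareInvariantSubspace.exists_forall_mem_closure {A B : SpecialLinearGroup n K}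
    (h : ShareInvariantSubspace A.1 B.1) :
    ∃ W : Submodule K (n → K), W ≠ ⊥ ∧ W ≠ ⊤ ∧
      ∀ g ∈ Subgroup.closure {A, B}, ∀ w ∈ W, g.1 *ᵥ w ∈ W := by
  obtain ⟨W, hbot, htop, hA, hB⟩ := h
  refine ⟨W, hbot, htop, fun g hg => mem_stabilizer_submodule_iff_forall_mulVec_mem.mp ?_⟩
  refine (Subgroup.closure_le _).mpr ?_ hg
  rintro _ (rfl | rfl)
  · exact mem_stabilizer_submodule_iff_forall_mulVec_mem.mpr hA
  · exact mem_stabilizer_submodule_iff_forall_mulVec_mem.mpr hB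

end Stabilizers

section CrossProduct

variable {K : Type*} [Field K] {u v x : Fin 3 → K}

lemma exists_eq_smul_of_cross_eq_zero (hv : v ≠ 0) (h : v ⨯₃ x = 0) : ∃ c : K, x = c • v := by
  by_contra! hx
  exact crossProduct_ne_zero_iff_linearIndependent.mpr
    ((LinearIndependent.pair_iff' hv).mpr fun c hc => hx c hc.symm) h

lemma exists_eq_smul_cross (huv : u ⨯₃ v ≠ 0) (hu : u ⬝ᵥ x = 0) (hv : v ⬝ᵥ x = 0) :
    ∃ c : K, x = c • u ⨯₃ v :=
  exists_eq_smul_of_cross_eq_zero huv <| by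
    rw [cross_cross_eq_smul_sub_smul, hu, hv, zero_smul, zero_smul, sub_zero]

end CrossProduct

section RankOnePerturbation

variable {n R : Type*} [Fintype n] [DecidableEq n] [CommRing R] {A : Matrix n n R}
  {x χ v φ : n → R}

lemma mulVec_eq_self_of_sub_one_eq_vecMulVec (hA : A - 1 = vecMulVec x χ) (hv : χ ⬝ᵥ v = 0) :
    A *ᵥ v = v := by
  rw [eq_add_of_sub_eq hA, add_mulVec, vecMulVec_mulVec, hv, MulOpposite.op_zero, zero_smul,
    zero_add, one_mulVec]

lemma vecMul_eq_self_of_sub_one_eq_vecMulVec (hA : A - 1 = vecMulVec x χ) (hφ : φ ⬝ᵥ x = 0) :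
    φ ᵥ* A = φ := by
  rw [eq_add_of_sub_eq hA, vecMul_add, vecMul_vecMulVec, hφ, zero_smul, zero_add, vecMul_one]

end RankOnePerturbation

lemma dotProduct_mulVec_eq_trace {n R : Type*} [Fintype n] [CommRing R] (N : Matrix n n R)
    (v φ : n → R) :
    φ ⬝ᵥ N *ᵥ v = (vecMulVec v φ * N).trace := by
  rw [vecMulVec_mul, trace_vecMulVec, dotProduct_mulVec, dotProduct_comm]

lemma exists_ne_zero_dotProduct_eq_zero_and {n K : Type*} [Fintype n] [Field K]
    (hn : 2 < Fintype.card n) (φ ψ : n → K) : ∃ v ≠ 0, φ ⬝ᵥ v = 0 ∧ ψ ⬝ᵥ v = 0 := by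
  obtain ⟨v, hv, hv0⟩ := Submodule.exists_mem_ne_zero_of_ne_bot
    (LinearMap.ker_ne_bot_of_finrank_lt (f := (of ![φ, ψ]).mulVecLin) (by simpa using hn))
  exact ⟨v, hv0, congrFun hv 0, congrFun hv 1⟩

section Adjugate

lemma det_sub_one_fin_three {R : Type*} [CommRing R] (M : Matrix (Fin 3) (Fin 3) R) :
    (M - 1).det = M.det - M.adjugate.trace + M.trace - 1 := by
  simp only [det_fin_three, adjugate_fin_three, trace_fin_three, one_fin_three,
    Matrix.sub_apply, of_apply, cons_val]
  ring

lemma adjugate_sub_one_fin_three {R : Type*} [CommRing R] (M : Matrix (Fin 3) (Fin 3) R) :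
    (M - 1).adjugate = M + M.adjugate + (1 - M.trace) • (1 : Matrix (Fin 3) (Fin 3) R) := by
  ext i j
  fin_cases i <;> fin_cases j <;>
    simp [adjugate_fin_three, trace_fin_three, one_apply] <;> ring

lemma transpose_adjugate_fin_three {R : Type*} [CommRing R] (M : Matrix (Fin 3) (Fin 3) R) :
    M.adjugateᵀ = of ![M 1 ⨯₃ M 2, M 2 ⨯₃ M 0, M 0 ⨯₃ M 1] := by
  ext i j
  fin_cases i <;> fin_cases j <;> simp [adjugate_fin_three, cross_apply] <;> ring

lemma row_cross_row_eq_zero_of_adjugate_eq_zero {R : Type*} [CommRing R]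
    {M : Matrix (Fin 3) (Fin 3) R} (h : M.adjugate = 0) (i k : Fin 3) :
    M i ⨯₃ M k = 0 := by
  have hrows : of ![M 1 ⨯₃ M 2, M 2 ⨯₃ M 0, M 0 ⨯₃ M 1] = 0 := by
    rw [← transpose_adjugate_fin_three, h, transpose_zero]
  have h12 : M 1 ⨯₃ M 2 = 0 := congrFun hrows 0
  have h20 : M 2 ⨯₃ M 0 = 0 := congrFun hrows 1
  have h01 : M 0 ⨯₃ M 1 = 0 := congrFun hrows 2
  have hswap {u v : Fin 3 → R} (huv : u ⨯₃ v = 0) : v ⨯₃ u = 0 := by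
    rw [← cross_anticomm, huv, neg_zero]
  fin_cases i <;> fin_cases k
  exacts [cross_self _, h01, hswap h20, hswap h01, cross_self _, h12, h20, hswap h12, cross_self _]

variable {K : Type*} [Field K] {M : Matrix (Fin 3) (Fin 3) K}

lemma exists_eq_vecMulVec_of_adjugate_eq_zero (h : M.adjugate = 0) :
    ∃ x χ : Fin 3 → K, M = vecMulVec x χ := by
  by_cases hM : M = 0
  · exact ⟨0, 0, by rw [hM, zero_vecMulVec]⟩
  · obtain ⟨i, hi⟩ : ∃ i, M i ≠ 0 := Function.ne_iff.mp hM
    choose c hc using fun k =>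
      exists_eq_smul_of_cross_eq_zero hi (row_cross_row_eq_zero_of_adjugate_eq_zero h i k)
    exact ⟨c, M i, funext hc⟩

lemma exists_adjugate_eq_vecMulVec (hM : M.det = 0) : ∃ v φ, M.adjugate = vecMulVec v φ := by
  apply exists_eq_vecMulVec_of_adjugate_eq_zero
  rw [adjugate_adjugate', hM, Fintype.card_fin, pow_one, zero_smul]

end Adjugate

section FixedPairs

variable {n K : Type*} [Fintype n] [Field K]

/-- A nonzero vector and a nonzero covector, both fixed by `A`; covectors are row
vectors, on which `A` acts from the right. -/
structure IsFixedPair (A : Matrix n n K) (v φ : n → K) : Prop where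
  vec_ne_zero : v ≠ 0
  covec_ne_zero : φ ≠ 0
  mulVec_eq : A *ᵥ v = v
  vecMul_eq : φ ᵥ* A = φ

lemma exists_isFixedPair_adjugate_eq {A : Matrix (Fin 3) (Fin 3) K} (hdet : (A - 1).det = 0)
    (hadj : (A - 1).adjugate ≠ 0) :
    ∃ v φ, IsFixedPair A v φ ∧ (A - 1).adjugate = vecMulVec v φ := by
  obtain ⟨v, φ, h⟩ := exists_adjugate_eq_vecMulVec hdet
  obtain ⟨hv, hφ⟩ : v ≠ 0 ∧ φ ≠ 0 := by rwa [h, Ne, vecMulVec_eq_zero, not_or] at hadj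
  have hvec : vecMulVec ((A - 1) *ᵥ v) φ = 0 := by
    rw [← mul_vecMulVec, ← h, mul_adjugate, hdet, zero_smul]
  have hcovec : vecMulVec v (φ ᵥ* (A - 1)) = 0 := by
    rw [← vecMulVec_mul, ← h, adjugate_mul, hdet, zero_smul]
  refine ⟨v, φ, ⟨hv, hφ, ?_, ?_⟩, h⟩
  · simpa [sub_mulVec, sub_eq_zero, hφ] using hvec
  · simpa [vecMul_sub, sub_eq_zero, hv] using hcovec

variable [DecidableEq n]

lemma exists_mulVec_eq_smul_of_dotProduct_eq_zero {B : SpecialLinearGroup n K} {v φ ψ p : n → K}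
    (hp : ∀ x, φ ⬝ᵥ x = 0 → ψ ⬝ᵥ x = 0 → ∃ c : K, x = c • p) (hψ : ψ ᵥ* B.1 = ψ)
    (hv : B.1 *ᵥ v ≠ v) (hφ : φ ⬝ᵥ (B.1 - 1) *ᵥ v = 0) (hφ' : φ ⬝ᵥ (B⁻¹.1 - 1) *ᵥ v = 0) :
    ∃ b : K, B.1 *ᵥ p = b • p := by
  have hmul : B.1 * B⁻¹.1 = 1 := congrArg Subtype.val (mul_inv_cancel B)
  have hBu : B.1 *ᵥ ((B⁻¹.1 - 1) *ᵥ v) = -((B.1 - 1) *ᵥ v) := by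
    rw [mulVec_mulVec, mul_sub, hmul, mul_one, ← neg_mulVec, neg_sub]
  have hψB : ψ ⬝ᵥ (B.1 - 1) *ᵥ v = 0 := by
    rw [dotProduct_mulVec, vecMul_sub, hψ, vecMul_one, sub_self, zero_dotProduct]
  have hψu : ψ ⬝ᵥ (B⁻¹.1 - 1) *ᵥ v = 0 := by
    rw [← hψ, ← dotProduct_mulVec, hBu, dotProduct_neg, hψB, neg_zero]
  obtain ⟨c, hc⟩ := hp _ hφ' hψu
  obtain ⟨d, hd⟩ := hp _ hφ hψB
  have hc0 : c ≠ 0 := by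
    rintro rfl
    rw [zero_smul] at hc
    rw [hc, mulVec_zero, eq_comm, neg_eq_zero, sub_mulVec, one_mulVec, sub_eq_zero] at hBu
    exact hv hBu
  refine ⟨c⁻¹ * -d, ?_⟩
  rw [mul_smul, eq_inv_smul_iff₀ hc0, ← mulVec_smul, ← hc, hBu, hd, neg_smul]

end FixedPairs

section CommonSubspace

variable {K : Type*} [Field K]

lemma shareInvariantSubspace_of_adjugate_eq_zero {A B : Matrix (Fin 3) (Fin 3) K}
    (hA : (A - 1).adjugate = 0) (hB : (B - 1).adjugate = 0) : ShareInvariantSubspace A B := by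
  obtain ⟨x, χ, hx⟩ := exists_eq_vecMulVec_of_adjugate_eq_zero hA
  obtain ⟨y, η, hy⟩ := exists_eq_vecMulVec_of_adjugate_eq_zero hB
  obtain ⟨v, hv, hχ, hη⟩ := exists_ne_zero_dotProduct_eq_zero_and (by simp) χ η
  exact shareInvariantSubspace_of_fixed_vector hv
    (mulVec_eq_self_of_sub_one_eq_vecMulVec hx hχ) (mulVec_eq_self_of_sub_one_eq_vecMulVec hy hη)

lemma shareInvariantSubspace_of_isFixedPair_of_adjugate_eq_zero {A B : Matrix (Fin 3) (Fin 3) K}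
    {v φ : Fin 3 → K}
    (hA : IsFixedPair A v φ) (hB : (B - 1).adjugate = 0) (hφ : φ ⬝ᵥ (B - 1) *ᵥ v = 0) :
    ShareInvariantSubspace A B := by
  obtain ⟨y, η, hy⟩ := exists_eq_vecMulVec_of_adjugate_eq_zero hB
  have hprod : (φ ⬝ᵥ y) * (η ⬝ᵥ v) = 0 := by
    rwa [hy, dotProduct_mulVec, vecMul_vecMulVec, smul_dotProduct, smul_eq_mul] at hφ
  rcases mul_eq_zero.mp hprod with h | h
  · exact shareInvariantSubspace_of_fixed_covector hA.covec_ne_zero hA.vecMul_eq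
      (vecMul_eq_self_of_sub_one_eq_vecMulVec hy h)
  · exact shareInvariantSubspace_of_fixed_vector hA.vec_ne_zero hA.mulVec_eq
      (mulVec_eq_self_of_sub_one_eq_vecMulVec hy h)

lemma shareInvariantSubspace_of_isFixedPair {A B : SL(3, K)} {v φ w ψ : Fin 3 → K}
    (hA : IsFixedPair A.1 v φ) (hB : IsFixedPair B.1 w ψ)
    (hφ : φ ⬝ᵥ (B.1 - 1) *ᵥ v = 0) (hφ' : φ ⬝ᵥ (B⁻¹.1 - 1) *ᵥ v = 0)
    (hψ : ψ ⬝ᵥ (A.1 - 1) *ᵥ w = 0) (hψ' : ψ ⬝ᵥ (A⁻¹.1 - 1) *ᵥ w = 0) :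
    ShareInvariantSubspace A.1 B.1 := by
  by_cases hBv : B.1 *ᵥ v = v
  · exact shareInvariantSubspace_of_fixed_vector hA.vec_ne_zero hA.mulVec_eq hBv
  by_cases hAw : A.1 *ᵥ w = w
  · exact shareInvariantSubspace_of_fixed_vector hB.vec_ne_zero hAw hB.mulVec_eq
  by_cases hcross : φ ⨯₃ ψ = 0
  · obtain ⟨c, rfl⟩ := exists_eq_smul_of_cross_eq_zero hA.covec_ne_zero hcross
    refine shareInvariantSubspace_of_fixed_covector hB.covec_ne_zero ?_ hB.vecMul_eq
    rw [smul_vecMul, hA.vecMul_eq]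
  obtain ⟨a, ha⟩ := exists_mulVec_eq_smul_of_dotProduct_eq_zero
    (fun _ h h' => exists_eq_smul_cross hcross h' h) hA.vecMul_eq hAw hψ hψ'
  obtain ⟨b, hb⟩ := exists_mulVec_eq_smul_of_dotProduct_eq_zero
    (fun _ h h' => exists_eq_smul_cross hcross h h') hB.vecMul_eq hBv hφ hφ'
  exact shareInvariantSubspace_of_eigenvector hcross ha hb

end CommonSubspace

section Traces

lemma trace_adjugate_sub_one_mul_sub_one {R : Type*} [CommRing R] (A B : SL(3, R))
    (hA : A⁻¹.1.trace = A.1.trace) :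
    ((A.1 - 1).adjugate * (B.1 - 1)).trace =
      (A * B).1.trace + (A⁻¹ * B).1.trace -
        (3 - A.1.trace - B.1.trace + A.1.trace * B.1.trace) := by
  have hadj : (A.1 - 1).adjugate = A.1 + A⁻¹.1 + (1 - A.1.trace) • (1 : Matrix _ _ R) :=
    adjugate_sub_one_fin_three A.1
  have hAB : (A * B).1 = A.1 * B.1 := rfl
  have hAB' : (A⁻¹ * B).1 = A⁻¹.1 * B.1 := rfl
  rw [hAB, hAB', hadj]
  simp only [add_mul, mul_sub, smul_mul_assoc, one_mul, mul_one, trace_add, trace_sub,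
    trace_smul, smul_eq_mul, hA, trace_one, Fintype.card_fin]
  push_cast
  ring

lemma det_sub_one_eq_zero_of_trace_inv_eq {R : Type*} [CommRing R] {A : SL(3, R)}
    (hA : A⁻¹.1.trace = A.1.trace) : (A.1 - 1).det = 0 := by
  have hadj : A.1.adjugate.trace = A.1.trace := hA
  rw [det_sub_one_fin_three, hadj, A.2]
  ring

variable {K : Type*} [Field K] {A B : SL(3, K)}

lemma shareInvariantSubspace_of_trace_adjugate_eq_zero
    (hA : (A.1 - 1).det = 0) (hB : (B.1 - 1).det = 0)
    (hAB : ((A.1 - 1).adjugate * (B.1 - 1)).trace = 0)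
    (hAB' : ((A.1 - 1).adjugate * (B⁻¹.1 - 1)).trace = 0)
    (hBA : ((B.1 - 1).adjugate * (A.1 - 1)).trace = 0)
    (hBA' : ((B.1 - 1).adjugate * (A⁻¹.1 - 1)).trace = 0) :
    ShareInvariantSubspace A.1 B.1 := by
  by_cases hA0 : (A.1 - 1).adjugate = 0 <;> by_cases hB0 : (B.1 - 1).adjugate = 0
  · exact shareInvariantSubspace_of_adjugate_eq_zero hA0 hB0
  · obtain ⟨w, ψ, hwψ, hadj⟩ := exists_isFixedPair_adjugate_eq hB hB0
    rw [hadj, ← dotProduct_mulVec_eq_trace] at hBA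
    exact (shareInvariantSubspace_of_isFixedPair_of_adjugate_eq_zero hwψ hA0 hBA).symm
  · obtain ⟨v, φ, hvφ, hadj⟩ := exists_isFixedPair_adjugate_eq hA hA0
    rw [hadj, ← dotProduct_mulVec_eq_trace] at hAB
    exact shareInvariantSubspace_of_isFixedPair_of_adjugate_eq_zero hvφ hB0 hAB
  · obtain ⟨v, φ, hvφ, hadjA⟩ := exists_isFixedPair_adjugate_eq hA hA0
    obtain ⟨w, ψ, hwψ, hadjB⟩ := exists_isFixedPair_adjugate_eq hB hB0
    rw [hadjA, ← dotProduct_mulVec_eq_trace] at hAB hAB'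
    rw [hadjB, ← dotProduct_mulVec_eq_trace] at hBA hBA'
    exact shareInvariantSubspace_of_isFixedPair hvφ hwψ hAB hAB' hBA hBA'

lemma trace_coe_mul_comm {n R : Type*} [Fintype n] [DecidableEq n] [CommRing R]
    (A B : SpecialLinearGroup n R) : (A * B).1.trace = (B * A).1.trace :=
  trace_mul_comm A.1 B.1

lemma shareInvariantSubspace_of_trace_eq
    (hA : A⁻¹.1.trace = A.1.trace) (hB : B⁻¹.1.trace = B.1.trace)
    (hmul : (A * B)⁻¹.1.trace = (A * B).1.trace)
    (hinv_mul : (A⁻¹ * B)⁻¹.1.trace = (A⁻¹ * B).1.trace)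
    (hsum : (A * B).1.trace + (A⁻¹ * B).1.trace =
      3 - A.1.trace - B.1.trace + A.1.trace * B.1.trace) :
    ShareInvariantSubspace A.1 B.1 := by
  have hinv_mul_inv : (A⁻¹ * B⁻¹).1.trace = (A * B).1.trace := by
    rw [trace_coe_mul_comm, ← _root_.mul_inv_rev, hmul]
  have hmul_inv : (A * B⁻¹).1.trace = (A⁻¹ * B).1.trace := by
    rw [trace_coe_mul_comm, ← hinv_mul, _root_.mul_inv_rev, inv_inv]
  refine shareInvariantSubspace_of_trace_adjugate_eq_zero
    (det_sub_one_eq_zero_of_trace_inv_eq hA) (det_sub_one_eq_zero_of_trace_inv_eq hB) ?_ ?_ ?_ ?_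
  · rw [trace_adjugate_sub_one_mul_sub_one A B hA]
    linear_combination hsum
  · rw [trace_adjugate_sub_one_mul_sub_one A B⁻¹ hA, hmul_inv, hinv_mul_inv, hB]
    linear_combination hsum
  · rw [trace_adjugate_sub_one_mul_sub_one B A hB, trace_coe_mul_comm B A,
      trace_coe_mul_comm B⁻¹ A, hmul_inv]
    linear_combination hsum
  · rw [trace_adjugate_sub_one_mul_sub_one B A⁻¹ hB, trace_coe_mul_comm B A⁻¹,
      trace_coe_mul_comm B⁻¹ A⁻¹, hinv_mul_inv, hA]
    linear_combination hsum

end Traces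

theorem theorem5p6_general {K : Type*} [Field K] (A B C : SL(3, K)) (hCBA : C * B * A = 1)
    (hA : A⁻¹.1.trace = A.1.trace) (hB : B⁻¹.1.trace = B.1.trace) (hC : C⁻¹.1.trace = C.1.trace)
    (hσ : (A⁻¹ * B).1.trace - A⁻¹.1.trace * B.1.trace =
      (B⁻¹ * A).1.trace - B⁻¹.1.trace * A.1.trace)
    (hred : (A⁻¹ * B).1.trace - A⁻¹.1.trace * B.1.trace =
      3 - A.1.trace - B.1.trace - C.1.trace) :
    ∃ W : Submodule K (Fin 3 → K), W ≠ ⊥ ∧ W ≠ ⊤ ∧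
      ∀ g ∈ Subgroup.closure {A, B, C}, ∀ w ∈ W, g.1 *ᵥ w ∈ W := by
  have hCinv : C⁻¹ = B * A := inv_eq_of_mul_eq_one_right (by rw [← mul_assoc, hCBA])
  have hmul : (A * B).1.trace = C.1.trace := by rw [trace_coe_mul_comm, ← hCinv, hC]
  have hmul_inv : (A * B)⁻¹.1.trace = C.1.trace := by
    rw [_root_.mul_inv_rev, trace_coe_mul_comm, ← _root_.mul_inv_rev, ← hCinv, inv_inv]
  have hinv_mul : (A⁻¹ * B)⁻¹.1.trace = (A⁻¹ * B).1.trace := by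
    rw [_root_.mul_inv_rev, inv_inv]
    linear_combination -hσ - hA * B.1.trace + hB * A.1.trace
  have hsum : (A * B).1.trace + (A⁻¹ * B).1.trace =
      3 - A.1.trace - B.1.trace + A.1.trace * B.1.trace := by
    linear_combination hmul + hred + hA * B.1.trace
  have hshare : ShareInvariantSubspace A.1 B.1 :=
    shareInvariantSubspace_of_trace_eq hA hB (hmul_inv.trans hmul.symm) hinv_mul hsum
  obtain ⟨W, hbot, htop, hW⟩ := hshare.exists_forall_mem_closure
  refine ⟨W, hbot, htop, fun g hg => hW g ((Subgroup.closure_le _).mpr ?_ hg)⟩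
  have hmemA : A ∈ Subgroup.closure {A, B} := Subgroup.subset_closure (by simp)
  have hmemB : B ∈ Subgroup.closure {A, B} := Subgroup.subset_closure (by simp)
  rintro _ (rfl | rfl | rfl)
  exacts [hmemA, hmemB, inv_mem_iff.mp (hCinv ▸ mul_mem hmemB hmemA)]

lemma isReducibleSubgroup_of_invariant {G : Subgroup SL(3, ℂ)} (W : Submodule ℂ (Fin 3 → ℂ))
    (hbot : W ≠ ⊥) (htop : W ≠ ⊤) (hW : ∀ g ∈ G, ∀ w ∈ W, g.1 *ᵥ w ∈ W) :
    IsReducibleSubgroup G := by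
  intro hirr
  let σ : Subrepresentation (standardRep G) :=
    { toSubmodule := W
      apply_mem_toSubmodule := fun g w hw => hW g.1 g.2 w hw }
  rcases hirr.eq_bot_or_eq_top σ with h | h
  · exact hbot (congrArg Subrepresentation.toSubmodule h)
  · exact htop (congrArg Subrepresentation.toSubmodule h)

theorem theorem5p6 (A B C : SL(3, ℂ))
    (hCBA : C * B * A = 1)
    (hA : slTrace A⁻¹ = slTrace A)
    (hB : slTrace B⁻¹ = slTrace B)
    (hC : slTrace C⁻¹ = slTrace C)
    (hAB : slTrace (⁅A, B⁆)⁻¹ = slTrace ⁅A, B⁆)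
    (hσ : shapePlus A B = shapeMinus A B)
    (hred : shapePlus A B = 3 - slTrace A - slTrace B - slTrace C) :
    IsReducibleSubgroup (Subgroup.closure {A, B, C}) := by
  obtain ⟨W, hbot, htop, hW⟩ := theorem5p6_general A B C hCBA hA hB hC hσ hred
  exact isReducibleSubgroup_of_invariant W hbot htop hW
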